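/- For nonzero integers $c_1,\dots,c_n$ let $[2c_1,2c_2,\dots,2c_n]$ denote the rational number $$\cfrac{1}{2c_1-\cfrac{1}{2c_2-\cfrac{1}{\ddots-\cfrac{1}{2c_n}}}}$$ (the empty expansion has the value $0$). A rational number $r$ has at most one such expansion; when it has one, let $K(r)$ be the oriented 2-bridge knot or link given by it, i.e. the boundary of the linear plumbing of $n$ unknotted annuli with $c_1,\dots,c_n$ full twists, in the sign convention in which $K(2/3)=K([2,2])$ is a trefoil knot and $K(2/5)=K([2,-2])$ is the figure eight knot. Let $\Delta_{K(r)}(t)$ be its Alexander polynomial, normalized within its class modulo $\pm t^k$ so that its constant term is nonzero and its leading coefficient is positive. Theorem. Let $m,p\ge 0$ be integers and let $a_1,\dots,a_{2m}$ and $b_1,\dots,b_{2p}$ be positive integers. Let $$r=[2a_1,2a_2,\dots,2a_{2m},\,2b_1,-2b_2,2b_3,-2b_4,\dots,2b_{2p-1},-2b_{2p}]$$ or $$r=[2b_1,-2b_2,2b_3,-2b_4,\dots,2b_{2p-1},-2b_{2p},\,2a_1,2a_2,\dots,2a_{2m}].$$ Then the 2-bridge knot $K(r)$ is bi-stable, i.e.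 every complex zero of $\Delta_{K(r)}(t)$ is real or has modulus $1$. Counted with multiplicity, $\Delta_{K(r)}(t)$ has exactly $2p$ real zeros and exactly $2m$ zeros of modulus $1$. -/

import Mathlib

open scoped Polynomial

/-! ## Even continued fractions -/

/-- The list `(a₁, …, aₙ)` encodes the even continued fraction
`[2a₁, …, 2aₙ] = 1 / (2a₁ - 1 / (2a₂ - ⋯ - 1 / (2aₙ)))`; the empty one has the value `0`. -/
def evenCF : List ℤ → ℚ
  | [] => 0
  | a :: c => 1 / (2 * (a : ℚ) - evenCF c)

/-- `r = [2a₁, …, 2aₙ]` with all `aᵢ ≠ 0`. -/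
def IsEvenExpansion (c : List ℤ) (r : ℚ) : Prop :=
  (∀ a ∈ c, a ≠ 0) ∧ evenCF c = r

theorem abs_evenCF_lt_one (c : List ℤ) (hc : ∀ a ∈ c, a ≠ 0) : |evenCF c| < 1 := by
  induction c with
  | nil => simp [evenCF]
  | cons a c ih =>
    have h := abs_lt.1 (ih fun x hx => hc x (List.mem_cons_of_mem a hx))
    have ha : a ≠ 0 := hc a (by simp)
    have h1 : 1 < |2 * (a : ℚ) - evenCF c| := by
      rcases lt_or_gt_of_ne ha with h2 | h2
      · have h3 : (a : ℚ) ≤ -1 := by exact_mod_cast (by omega : a ≤ -1)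
        rw [lt_abs]; right; linarith [h.1, h.2]
      · have h3 : (1 : ℚ) ≤ a := by exact_mod_cast (by omega : 1 ≤ a)
        rw [lt_abs]; left; linarith [h.1, h.2]
    rw [evenCF, abs_div, abs_one, div_lt_one (by linarith)]
    exact h1

/-- A rational number has at most one even continued fraction expansion. -/
theorem evenExpansion_unique (c d : List ℤ) (r : ℚ) (hc : IsEvenExpansion c r)
    (hd : IsEvenExpansion d r) : c = d := by
  have key : ∀ (a : ℤ) (l : List ℤ), (∀ x ∈ a :: l, x ≠ 0) → evenCF (a :: l) ≠ 0 := by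
    intro a l h h0
    have h1 := abs_lt.1 (abs_evenCF_lt_one l fun x hx => h x (List.mem_cons_of_mem a hx))
    have ha : a ≠ 0 := h a (by simp)
    rw [evenCF, one_div, inv_eq_zero] at h0
    rcases lt_or_gt_of_ne ha with h2 | h2
    · have h3 : (a : ℚ) ≤ -1 := by exact_mod_cast (by omega : a ≤ -1)
      linarith [h1.1, h1.2]
    · have h3 : (1 : ℚ) ≤ a := by exact_mod_cast (by omega : 1 ≤ a)
      linarith [h1.1, h1.2]
  induction c generalizing d r with
  | nil =>
    cases d with
    | nil => rfl
    | cons b d => exact absurd (hd.2.trans hc.2.symm) (key b d hd.1)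
  | cons a c ih =>
    cases d with
    | nil => exact absurd (hc.2.trans hd.2.symm) (key a c hc.1)
    | cons b d =>
      have hc' : ∀ x ∈ c, x ≠ 0 := fun x hx => hc.1 x (List.mem_cons_of_mem a hx)
      have hd' : ∀ x ∈ d, x ≠ 0 := fun x hx => hd.1 x (List.mem_cons_of_mem b hx)
      have h1 := abs_lt.1 (abs_evenCF_lt_one c hc')
      have h2 := abs_lt.1 (abs_evenCF_lt_one d hd')
      have h3 : evenCF (a :: c) = evenCF (b :: d) := hc.2.trans hd.2.symm
      simp only [evenCF, one_div, inv_inj] at h3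
      have h4 : a = b := by
        have h5 : (a : ℚ) - b < 1 := by linarith [h1.1, h1.2, h2.1, h2.2]
        have h6 : (b : ℚ) - a < 1 := by linarith [h1.1, h1.2, h2.1, h2.2]
        have h7 : a - b < 1 := by exact_mod_cast h5
        have h8 : b - a < 1 := by exact_mod_cast h6
        omega
      subst h4
      rw [ih d (evenCF c) ⟨hc', rfl⟩ ⟨hd', by linarith⟩]

open Classical in
/-- The even continued fraction expansion of `r` (the empty list if `r` has none). -/
noncomputable def evenExpansion (r : ℚ) : List ℤ :=
  if h : ∃ c, IsEvenExpansion c r then h.choose else []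

/-! ## Link diagrams and the Alexander polynomial -/

/-- A crossing of an oriented diagram: the overcrossing arc, and the two arcs of the understrand
to the left and to the right of the oriented overcrossing arc. -/
structure Crossing where
  overArc : ℕ
  leftArc : ℕ
  rightArc : ℕ

/-- The combinatorial data of an oriented link diagram.  The arcs are numbered
`0, …, numArcs - 1`; besides ending at undercrossings, arcs may be cut at a crossingless point of
the diagram, and then the pair of the two arcs that meet there is listed in `joins`. -/
structure LinkDiagram where
  numArcs : ℕ
  crossings : List Crossing
  joins : List (ℕ × ℕ)

/-- The row of the Alexander matrix of a crossing: `1 - t` at the overcrossing arc, `-1` at the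
arc on its left, `t` at the arc on its right (contributions of coinciding arcs add up). -/
noncomputable def Crossing.row (x : Crossing) (j : ℕ) : ℤ[X] :=
  (if j = x.overArc then 1 - Polynomial.X else 0) + (if j = x.leftArc then -1 else 0)
    + (if j = x.rightArc then Polynomial.X else 0)

/-- The row that identifies two arcs. -/
noncomputable def joinRow (e : ℕ × ℕ) (j : ℕ) : ℤ[X] :=
  (if j = e.1 then 1 else 0) + (if j = e.2 then -1 else 0)

/-- All rows of the Alexander matrix: first those of the crossings, then those of the joins.
This is the abelianized Fox Jacobian of the Wirtinger presentation of the diagram. -/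
noncomputable def LinkDiagram.rows (D : LinkDiagram) : List (ℕ → ℤ[X]) :=
  D.crossings.map Crossing.row ++ D.joins.map joinRow

/-- The Alexander matrix of a diagram (as many relations as arcs), with the last row and the
column of arc `0` deleted.  For the diagram of a link, deleting another row or another column
changes the determinant only by a unit `±tᵏ`. -/
noncomputable def LinkDiagram.reducedAlexanderMatrix (D : LinkDiagram) :
    Matrix (Fin (D.numArcs - 1)) (Fin (D.numArcs - 1)) ℤ[X] :=
  Matrix.of fun i j => (D.rows.getD i 0) (j + 1)

/-- The representative of a polynomial modulo units `±tᵏ` that has a nonzero constant term and a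
positive leading coefficient. -/
noncomputable def normalizeUnit (f : ℤ[X]) : ℤ[X] :=
  Polynomial.C (Int.sign f.leadingCoeff) * (f /ₘ Polynomial.X ^ f.natTrailingDegree)

/-- The Alexander polynomial of the link given by a diagram, normalized to have a nonzero
constant term and a positive leading coefficient.  (For a link with several components this is
the reduced, one-variable Alexander polynomial.) -/
noncomputable def LinkDiagram.alexander (D : LinkDiagram) : ℤ[X] :=
  normalizeUnit D.reducedAlexanderMatrix.det

/-! ## Plats on four strands and 2-bridge links -/

/-- A generator of the braid group on the strands `0, 1, 2, 3`, read downwards: the strands at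
the positions `pos` and `pos + 1` cross.  If `leftOver` is true, the strand that comes from the
left position passes over, otherwise the one that comes from the right position does. -/
structure BraidLetter where
  pos : Fin 3
  leftOver : Bool

/-- A horizontal section of a plat: at each position the number of the arc there, and whether it
is oriented downwards. -/
abbrev Section := Fin 4 → ℕ × Bool

/-- The section below a crossing; the understrand continues as the new arc `n`. -/
def BraidLetter.step (x : BraidLetter) (s : Section) (n : ℕ) : Section :=
  let i := x.pos.castSucc
  let j := x.pos.succ
  if x.leftOver then
    Function.update (Function.update s j (s i)) i (n, (s j).2)
  else
    Function.update (Function.update s i (s j)) j (n, (s i).2)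

/-- The crossing that a braid letter produces below the section `s`.  If the overstrand comes
from the left and is oriented downwards, then the old arc of the understrand lies on its left;
this is reversed when the overstrand is oriented upwards, and reversed when it comes from the
right. -/
def BraidLetter.crossing (x : BraidLetter) (s : Section) (n : ℕ) : Crossing :=
  let i := x.pos.castSucc
  let j := x.pos.succ
  if x.leftOver then
    if (s i).2 then ⟨(s i).1, (s j).1, n⟩ else ⟨(s i).1, n, (s j).1⟩
  else
    if (s j).2 then ⟨(s j).1, n, (s i).1⟩ else ⟨(s j).1, (s i).1, n⟩

/-- The crossings of a braid word that starts at the section `s`; new arcs are numbered from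
`n` on. -/
def braidCrossings : List BraidLetter → Section → ℕ → List Crossing
  | [], _, _ => []
  | x :: w, s, n => x.crossing s n :: braidCrossings w (x.step s n) (n + 1)

/-- The section at the bottom of a braid word. -/
def braidBottom : List BraidLetter → Section → ℕ → Section
  | [], s, _ => s
  | x :: w, s, n => braidBottom w (x.step s n) (n + 1)

/-- The top of a plat: a maximum (arc `0`) joins the positions `0, 1` and a maximum (arc `1`)
joins the positions `2, 3`.  The strands are oriented down, up, down, up. -/
def platTop : Section := ![(0, true), (0, false), (1, true), (1, false)]

/-- The twists of the even continued fraction `[2a₁, …, 2aₙ]`: `2|a₁|` crossings of the two middle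
strands, then `2|a₂|` crossings of the two left strands, then `2|a₃|` crossings of the two middle
strands, and so on; the handedness of the `i`-th twist is given by the sign of `aᵢ`.  The flag
tells whether the next twist is in the middle. -/
def twistWord : Bool → List ℤ → List BraidLetter
  | _, [] => []
  | mid, a :: c =>
    List.replicate (2 * a.natAbs) ⟨if mid then 1 else 0, decide (0 < a)⟩ ++ twistWord (!mid) c

/-- The standard oriented diagram (a plat on four strands) of the 2-bridge link of
`[2a₁, …, 2aₙ]`.  It bounds the linear plumbing of unknotted annuli with `a₁, …, aₙ` full twists:
the two strands in each twist are antiparallel, so that the even number of crossings in each twist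
keeps the orientations at the four positions.  At the bottom, minima join the
positions `1, 2` and `0, 3` if `n` is even (a knot), and `0, 1` and `2, 3` if `n` is odd (a link
with two components). -/
def platDiagram (c : List ℤ) : LinkDiagram :=
  let w := twistWord true c
  let s := braidBottom w platTop 2
  { numArcs := w.length + 2
    crossings := braidCrossings w platTop 2
    joins :=
      if Even c.length then [((s 1).1, (s 2).1), ((s 0).1, (s 3).1)]
      else [((s 0).1, (s 1).1), ((s 2).1, (s 3).1)] }

/-- The 2-bridge knot or link `K(r)`. -/
noncomputable def twoBridge (r : ℚ) : LinkDiagram :=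
  platDiagram (evenExpansion r)

/-! ## Bi-stability -/

/-- A real polynomial is bi-stable if each of its complex zeros is real or has modulus `1`. -/
def IsBiStable (f : ℝ[X]) : Prop :=
  ∀ z : ℂ, Polynomial.aeval z f = 0 → z.im = 0 ∨ ‖z‖ = 1

open Classical in
/-- The number of real zeros, with multiplicity. -/
noncomputable def numRealZeros (f : ℝ[X]) : ℕ :=
  (f.aroots ℂ).countP fun z => z.im = 0

open Classical in
/-- The number of zeros of modulus `1`, with multiplicity. -/
noncomputable def numUnitZeros (f : ℝ[X]) : ℕ :=
  (f.aroots ℂ).countP fun z => ‖z‖ = 1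

/-- The Alexander polynomial of `K(r)` as a real polynomial. -/
noncomputable def alexanderTwoBridge (r : ℚ) : ℝ[X] :=
  (twoBridge r).alexander.map (Int.castRingHom ℝ)

/-- The block `2a₁, 2a₂, …, 2aₙ`. -/
def constantBlock {n : ℕ} (a : Fin n → ℤ) : List ℤ :=
  List.ofFn a

/-- The block `2b₁, -2b₂, 2b₃, -2b₄, …` (note that the first index is `0`). -/
def alternatingBlock {n : ℕ} (b : Fin n → ℤ) : List ℤ :=
  List.ofFn fun k : Fin n => (-1) ^ (k : ℕ) * b k

/-! For fixed real `t ≠ 0`, colour the arcs from top to bottom so that every crossing relation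
holds, starting with colours 0 and 1 on the two maxima. A twist region is antiparallel, so it shifts
the colours of its two strands by the same amount. In suitable difference coordinates `(u, v)`, a
middle twist and the following left twist act by `u ↦ u + o * v`, `v ↦ v + e * w * u`, with `w = (t
- 1) ^ 2 / t` and `o`, `e` consecutive coefficients of the continued fraction. The closing condition
is `v = 0`, and `exists_aeval_det_platDiagram` identifies the Alexander determinant with the final
`v`, up to a factor `±t ^ b`.

In both families the block boundary has even index, so every `o` is positive; `e` is positive in the
constant block and negative in the alternating one. Since `o > 0`, the final `v` is, up to a
constant, the determinant of `w * diag(e) + Bᵀ * B` with `B` real and invertible. Diagonalizing this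
pencil gives `v = ∏ (1 + w * μ i)` with real `μ i`, whose signs are distributed like those of the `e
k` by Sylvester's law of inertia (`exists_plumbingSeq_eq_prod`).

Clearing denominators, each factor becomes `μ * (t - 1) ^ 2 + t`, of discriminant `1 - 4 * μ`. Its
zeros are real if `μ < 0`, and nonreal of modulus 1 if `μ > 1 / 4`. The range `0 < μ ≤ 1 / 4` would
produce a zero of `v` at some `w ≤ -4`; a growth estimate using only `|o|, |e| ≥ 1` excludes this
(`plumbingSeq_snd_ne_zero`). Each factor accounts for two zeros. -/

/-! ## Linear algebra -/

/-- The determinant of a lower Hessenberg matrix, in terms of a vector that is annihilated by all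
rows but the last one. -/
theorem Matrix.det_mul_of_hessenberg {R : Type*} [CommRing R] {n : ℕ}
    (M : Matrix (Fin (n + 1)) (Fin (n + 1)) R)
    (hM : ∀ i j : Fin (n + 1), (i : ℕ) + 1 < j → M i j = 0) (x : Fin (n + 1) → R)
    (hx : ∀ i : Fin n, M.mulVec x i.castSucc = 0) :
    M.det * x 0 =
      (-1) ^ n * M.mulVec x (Fin.last n) * ∏ i : Fin n, M i.castSucc i.succ := by
  -- Cramer's rule. The new column 0 has only its last entry nonzero, so expansion along it leaves a
  -- single minor, which is triangular with the superdiagonal of `M` on its diagonal.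
  have h1 : M.det * x 0 = (M.updateCol 0 (M.mulVec x)).det := by
    rw [← Matrix.cramer_apply, Matrix.cramer_eq_adjugate_mulVec, Matrix.mulVec_mulVec,
      Matrix.adjugate_mul, Matrix.smul_mulVec, Matrix.one_mulVec]
    simp
  rw [h1, Matrix.det_succ_column_zero, Fin.sum_univ_castSucc]
  simp only [Matrix.updateCol_self, hx, mul_zero, zero_mul, Finset.sum_const_zero, zero_add,
    Fin.val_last, Fin.succAbove_last]
  congr 1
  rw [Matrix.det_of_isLowerTriangular]
  · refine Finset.prod_congr rfl fun i _ => ?_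
    rw [Matrix.submatrix_apply, Matrix.updateCol_ne (Fin.succ_ne_zero i)]
  · intro i j hij
    have hij' : (i : ℕ) < j := hij
    rw [Matrix.submatrix_apply, Matrix.updateCol_ne (Fin.succ_ne_zero j)]
    exact hM _ _ (by simpa using hij')

/-- The positive index of inertia of a real diagonal form does not exceed that of a diagonal form
from which it arises by a substitution. -/
theorem card_pos_le_of_diagonal_eq {ι κ : Type*} [Fintype ι] [Fintype κ] [DecidableEq ι]
    [DecidableEq κ] (R : Matrix κ ι ℝ) (μ : ι → ℝ) (d : κ → ℝ)
    (h : Matrix.diagonal μ = R.transpose * Matrix.diagonal d * R) :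
    Fintype.card {i // 0 < μ i} ≤ Fintype.card {k // 0 < d k} := by
  by_contra! hlt
  -- A kernel vector of this block, extended by zero, is supported where `μ > 0` and is sent by `R`
  -- to a vector vanishing where `d > 0`. The common quadratic form would be both positive and
  -- nonpositive on it.
  let L := Matrix.toLin' (R.submatrix (Subtype.val : {k // 0 < d k} → κ)
    (Subtype.val : {i // 0 < μ i} → ι))
  have hker : LinearMap.ker L ≠ ⊥ := LinearMap.ker_ne_bot_of_finrank_lt (by simpa using hlt)
  obtain ⟨c, hc, hc0⟩ := Submodule.exists_mem_ne_zero_of_ne_bot hker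
  let x : ι → ℝ := fun i => if hi : 0 < μ i then c ⟨i, hi⟩ else 0
  have hquad : ∑ i, μ i * x i ^ 2 = ∑ k, d k * (R.mulVec x k) ^ 2 := by
    have h1 : x ⬝ᵥ (Matrix.diagonal μ).mulVec x = ∑ i, μ i * x i ^ 2 := by
      simp only [dotProduct, Matrix.mulVec_diagonal]
      exact Finset.sum_congr rfl fun i _ => by ring
    have h2 : x ⬝ᵥ (Matrix.diagonal μ).mulVec x = ∑ k, d k * (R.mulVec x k) ^ 2 := by
      rw [h, ← Matrix.mulVec_mulVec, ← Matrix.mulVec_mulVec, Matrix.dotProduct_mulVec,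
        Matrix.vecMul_transpose]
      simp only [dotProduct, Matrix.mulVec_diagonal]
      exact Finset.sum_congr rfl fun i _ => by ring
    rw [← h1, h2]
  have hzero : ∀ k, 0 < d k → R.mulVec x k = 0 := by
    intro k hk
    have h1 := congrFun (LinearMap.mem_ker.1 hc) ⟨k, hk⟩
    simp only [L, Matrix.toLin'_apply, Matrix.mulVec, dotProduct, Matrix.submatrix_apply,
      Pi.zero_apply] at h1
    rw [Matrix.mulVec, dotProduct, ← h1]
    symm
    rw [← Finset.sum_subset (Finset.subset_univ (Finset.univ.filter fun i => 0 < μ i)),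
      Finset.sum_subtype (p := fun i => 0 < μ i) _ (by simp)]
    · exact Finset.sum_congr rfl fun i _ => by simp [x, i.2]
    · intro i _ hi
      have : ¬ 0 < μ i := by simpa using hi
      simp [x, this]
  have hnonpos : ∑ k, d k * (R.mulVec x k) ^ 2 ≤ 0 := by
    refine Finset.sum_nonpos fun k _ => ?_
    by_cases hk : 0 < d k
    · simp [hzero k hk]
    · exact mul_nonpos_of_nonpos_of_nonneg (not_lt.1 hk) (sq_nonneg _)
  have hpos : 0 < ∑ i, μ i * x i ^ 2 := by
    obtain ⟨i, hi⟩ := Function.ne_iff.1 hc0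
    refine Finset.sum_pos' (fun j _ => ?_) ⟨i, Finset.mem_univ _, ?_⟩
    · by_cases hj : 0 < μ j
      · positivity
      · simp [x, hj]
    · have hxi : x i = c i := by simp [x, i.2]
      have := i.2
      have hne : c i ≠ 0 := hi
      rw [hxi]
      positivity
  linarith

/-- A pencil spanned by a positive definite form and a nondegenerate diagonal form has a real
diagonalization, whose inertia is that of the diagonal form. -/
theorem exists_det_pencil_eq_prod {n : ℕ} (B : Matrix (Fin n) (Fin n) ℝ) (hB : B.det ≠ 0)
    (d : Fin n → ℝ) (hd : ∀ i, d i ≠ 0) :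
    ∃ μ : Fin n → ℝ,
      (∀ w : ℝ, (w • Matrix.diagonal d + B.transpose * B).det
        = (B.transpose * B).det * ∏ i, (1 + w * μ i)) ∧
      (∀ i, μ i ≠ 0) ∧
      Fintype.card {i // 0 < μ i} = Fintype.card {i // 0 < d i} ∧
      Fintype.card {i // μ i < 0} = Fintype.card {i // d i < 0} := by
  have hBu : IsUnit B.det := hB.isUnit
  -- The pencil equals `Bᵀ * (1 + w • H) * B`, so the required `μ` are the eigenvalues of the
  -- symmetric matrix `H`.
  let H := (B⁻¹).transpose * Matrix.diagonal d * B⁻¹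
  have hH : H.IsHermitian := by
    rw [Matrix.IsHermitian, Matrix.conjTranspose_eq_transpose_of_trivial]
    simp [H, Matrix.transpose_mul, Matrix.mul_assoc]
  let U : Matrix (Fin n) (Fin n) ℝ := hH.eigenvectorUnitary
  let μ := hH.eigenvalues
  have hUU : U.transpose * U = 1 := by
    have := Unitary.coe_star_mul_self hH.eigenvectorUnitary
    rwa [Matrix.star_eq_conjTranspose, Matrix.conjTranspose_eq_transpose_of_trivial] at this
  have hUU' : U * U.transpose = 1 := mul_eq_one_comm.1 hUU
  have hspec : H = U * Matrix.diagonal μ * U.transpose := by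
    have := hH.spectral_theorem
    rw [Unitary.conjStarAlgAut_apply] at this
    rw [this]
    simp [U, μ, Matrix.star_eq_conjTranspose]
  have hdiag : Matrix.diagonal μ = (B⁻¹ * U).transpose * Matrix.diagonal d * (B⁻¹ * U) := by
    have : U.transpose * H * U = Matrix.diagonal μ := by
      rw [hspec]
      calc U.transpose * (U * Matrix.diagonal μ * U.transpose) * U
          = (U.transpose * U) * Matrix.diagonal μ * (U.transpose * U) := by
            simp only [Matrix.mul_assoc]
        _ = _ := by simp [hUU]
    rw [← this]
    simp only [H, Matrix.transpose_mul, Matrix.mul_assoc]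
  have hdet : ∀ w : ℝ, (w • Matrix.diagonal d + B.transpose * B).det
        = (B.transpose * B).det * ∏ i, (1 + w * μ i) := by
    intro w
    have hBB : B⁻¹ * B = 1 := Matrix.nonsing_inv_mul B hBu
    have hBBt : B.transpose * (B⁻¹).transpose = 1 := by
      rw [← Matrix.transpose_mul, hBB, Matrix.transpose_one]
    have h1 : B.transpose * H * B = Matrix.diagonal d := by
      calc B.transpose * H * B
          = (B.transpose * (B⁻¹).transpose) * Matrix.diagonal d * (B⁻¹ * B) := by
            simp only [H, Matrix.mul_assoc]
        _ = _ := by simp [hBB, hBBt]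
    have h2 : U * Matrix.diagonal (fun i => 1 + w * μ i) * U.transpose = 1 + w • H := by
      have : Matrix.diagonal (fun i => 1 + w * μ i) = 1 + w • Matrix.diagonal μ := by
        rw [← Matrix.diagonal_one, ← Matrix.diagonal_smul, Matrix.diagonal_add]
        rfl
      rw [this, hspec, Matrix.mul_add, Matrix.add_mul]
      simp [hUU']
    have h3 : w • Matrix.diagonal d + B.transpose * B = B.transpose * (1 + w • H) * B := by
      rw [Matrix.mul_add, Matrix.add_mul, ← h1]
      simp [add_comm]
    have hU : U.det * U.det = 1 := by
      have := congrArg Matrix.det hUU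
      simpa using this
    rw [h3, ← h2]
    simp only [Matrix.det_mul, Matrix.det_transpose, Matrix.det_diagonal]
    linear_combination B.det * B.det * (∏ i, (1 + w * μ i)) * hU
  have hμ : ∀ i, μ i ≠ 0 := by
    have h1 : (Matrix.diagonal μ).det ≠ 0 := by
      have h2 : (B⁻¹).det ≠ 0 := by
        rw [Matrix.det_nonsing_inv]
        simpa using hB
      have h3 : U.det ≠ 0 := fun h => by
        have := congrArg Matrix.det hUU
        simp [h] at this
      rw [hdiag]
      simp only [Matrix.det_mul, Matrix.det_transpose, Matrix.det_diagonal]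
      have h4 : ∏ i, d i ≠ 0 := Finset.prod_ne_zero_iff.2 fun i _ => hd i
      positivity
    rw [Matrix.det_diagonal] at h1
    exact fun i => Finset.prod_ne_zero_iff.1 h1 i (Finset.mem_univ _)
  -- One inequality for each sign suffices: neither `μ` nor `d` has a zero entry, so both pairs of
  -- counts add up to `n` and equality follows.
  have hp := card_pos_le_of_diagonal_eq _ _ _ hdiag
  have hn := card_pos_le_of_diagonal_eq (B⁻¹ * U) (fun i => -μ i) (fun i => -d i) (by
    have h1 : (Matrix.diagonal fun i => -μ i) = -Matrix.diagonal μ :=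
      (Matrix.diagonal_neg _).symm
    have h2 : (Matrix.diagonal fun i => -d i) = -Matrix.diagonal d :=
      (Matrix.diagonal_neg _).symm
    rw [h1, h2, hdiag, Matrix.mul_neg, Matrix.neg_mul])
  simp only [neg_pos] at hn
  have htot : ∀ f : Fin n → ℝ, (∀ i, f i ≠ 0) →
      Fintype.card {i // 0 < f i} + Fintype.card {i // f i < 0} = n := by
    intro f hf
    rw [Fintype.card_subtype, Fintype.card_subtype]
    have : (Finset.univ.filter fun i => f i < 0) = Finset.univ.filter fun i => ¬ 0 < f i := by
      refine Finset.filter_congr fun i _ => ?_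
      rw [not_lt]
      exact ⟨le_of_lt, fun h => lt_of_le_of_ne h (hf i)⟩
    rw [this, Finset.card_filter_add_card_filter_not]
    simp
  have ht1 := htot μ hμ
  have ht2 := htot d hd
  exact ⟨μ, hdet, hμ, by omega, by omega⟩

/-! ## The two-step recursion of a linear plumbing -/

/-- The recursion `u ↦ u + o k * v`, `v ↦ v + e k * w * u`. -/
noncomputable def plumbingSeq (o e : ℕ → ℝ) (w : ℝ) (s : ℝ × ℝ) : ℕ → ℝ × ℝ
  | 0 => s
  | k + 1 =>
    ((plumbingSeq o e w s k).1 + o k * (plumbingSeq o e w s k).2,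
      (plumbingSeq o e w s k).2
        + e k * w * ((plumbingSeq o e w s k).1 + o k * (plumbingSeq o e w s k).2))

/-- The recursion is defined by adding a last step, while induction on a twist word removes the
first one. -/
theorem plumbingSeq_succ_eq_shift (o e : ℕ → ℝ) (w : ℝ) (s : ℝ × ℝ) (n : ℕ) :
    plumbingSeq o e w s (n + 1) =
      plumbingSeq (fun k => o (k + 1)) (fun k => e (k + 1)) w
        (s.1 + o 0 * s.2, s.2 + e 0 * w * (s.1 + o 0 * s.2)) n := by
  induction n with
  | zero => rfl
  | succ n ih => rw [plumbingSeq, ih, plumbingSeq]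

/-- The recursion has no zero for `w ≤ -4` if all coefficients have absolute value at least
`1`. -/
theorem plumbingSeq_snd_ne_zero (o e : ℕ → ℝ) (w : ℝ) (hw : w ≤ -4) (n : ℕ)
    (ho : ∀ k < n, 1 ≤ |o k|) (he : ∀ k < n, 1 ≤ |e k|) :
    (plumbingSeq o e w (0, 1) n).2 ≠ 0 := by
  set y := √(-w)
  have hyy : y * y = -w := Real.mul_self_sqrt (by linarith)
  have hy : 2 ≤ y := Real.le_sqrt_of_sq_le (by linarith)
  -- The cone `y * |u| < |v|` is invariant: `|u'| ≥ |v| - |u|` gives `y * |u'| > (y - 1) * |v| ≥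
  -- |v|`, and then `|v'| ≥ y ^ 2 * |u'| - |v| > y * (y - 1) * |u'| ≥ y * |u'|`. Both steps use `y ≥
  -- 2`, that is `w ≤ -4`.
  have key : ∀ k ≤ n, y * |(plumbingSeq o e w (0, 1) k).1| < |(plumbingSeq o e w (0, 1) k).2| := by
    intro k
    induction k with
    | zero => simp [plumbingSeq]
    | succ k ih =>
      intro hk
      have h := ih (by omega)
      simp only [plumbingSeq]
      set u := (plumbingSeq o e w (0, 1) k).1
      set v := (plumbingSeq o e w (0, 1) k).2
      set u' := u + o k * v
      have h1 : |v| ≤ |o k| * |v| := le_mul_of_one_le_left (abs_nonneg _) (ho k (by omega))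
      have h2 : |o k| * |v| ≤ |u'| + |u| := by
        rw [← abs_mul, show o k * v = u' - u by ring]
        exact abs_sub _ _
      have h3 : |u'| ≤ |e k| * |u'| := le_mul_of_one_le_left (abs_nonneg _) (he k (by omega))
      have h4 : y * y * (|e k| * |u'|) ≤ |v + e k * w * u'| + |v| := by
        have : y * y * (|e k| * |u'|) = |e k * w * u'| := by
          rw [abs_mul, abs_mul, abs_of_nonpos (by linarith : w ≤ 0), hyy]
          ring
        have h := abs_sub (v + e k * w * u') v
        rwa [add_sub_cancel_left, ← this] at h
      have h5 : |v| < y * |u'| := by nlinarith [abs_nonneg u, abs_nonneg v, abs_nonneg u']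
      have h6 : y * y * |u'| ≤ y * y * (|e k| * |u'|) := by gcongr
      have h7 : 0 ≤ y * |u'| := by positivity
      nlinarith [mul_nonneg h7 (sub_nonneg.2 hy)]
  have := key n le_rfl
  intro h0
  rw [h0, abs_zero] at this
  have : 0 ≤ y * |(plumbingSeq o e w (0, 1) n).1| := by positivity
  linarith

/-- The bidiagonal matrix with diagonal entries `s i` and subdiagonal entries `-s i`. -/
def bidiagonal (n : ℕ) (s : ℕ → ℝ) : Matrix (Fin n) (Fin n) ℝ :=
  Matrix.of fun i j =>
    (if (j : ℕ) = i then s i else 0) + (if (j : ℕ) + 1 = i then -s i else 0)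

theorem det_bidiagonal (n : ℕ) (s : ℕ → ℝ) :
    (bidiagonal n s).det = ∏ i : Fin n, s i := by
  rw [Matrix.det_of_isLowerTriangular]
  · simp [bidiagonal]
  · intro i j hij
    have hij' : (i : ℕ) < j := hij
    simp only [bidiagonal, Matrix.of_apply]
    rw [if_neg (by omega), if_neg (by omega), add_zero]

/-- Row 0 has no subdiagonal entry; `u 0 = 0` lets the difference formula cover it too. -/
theorem bidiagonal_mulVec (n : ℕ) (s u : ℕ → ℝ) (hu : u 0 = 0) (i : Fin n) :
    (bidiagonal n s).mulVec (fun j => u (j + 1)) i = s i * (u (i + 1) - u i) := by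
  simp only [Matrix.mulVec, dotProduct, bidiagonal, Matrix.of_apply, add_mul, ite_mul, zero_mul,
    Finset.sum_add_distrib]
  rw [Fin.sum_univ_eq_sum_range (fun j => if j = (i : ℕ) then s i * u (j + 1) else 0) n,
    Fin.sum_univ_eq_sum_range (fun j => if j + 1 = (i : ℕ) then -s i * u (j + 1) else 0) n]
  rw [Finset.sum_ite_eq', if_pos (Finset.mem_range.2 i.2)]
  obtain ⟨i, hi⟩ := i
  cases i with
  | zero => simp [hu]
  | succ i =>
    simp only [Nat.add_right_cancel_iff]
    rw [Finset.sum_ite_eq', if_pos (Finset.mem_range.2 (by omega))]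
    ring

theorem bidiagonal_transpose_mulVec (n : ℕ) (s y : ℕ → ℝ) (k : Fin n) :
    (bidiagonal n s).transpose.mulVec (fun i => y i) k =
      s k * y k - if (k : ℕ) + 1 < n then s (k + 1) * y (k + 1) else 0 := by
  simp only [Matrix.mulVec, dotProduct, bidiagonal, Matrix.transpose_apply, Matrix.of_apply,
    add_mul, ite_mul, zero_mul, Finset.sum_add_distrib]
  rw [Fin.sum_univ_eq_sum_range (fun j => if (k : ℕ) = j then s j * y j else 0) n,
    Fin.sum_univ_eq_sum_range (fun j => if (k : ℕ) + 1 = j then -s j * y j else 0) n]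
  rw [Finset.sum_ite_eq, Finset.sum_ite_eq, if_pos (Finset.mem_range.2 k.2)]
  simp only [Finset.mem_range]
  split_ifs <;> ring

/-- Entries above the diagonal are enough for the Hessenberg argument; the action on a vector is
computed through the two factors instead. -/
theorem bidiagonal_gram_apply (n : ℕ) (s : ℕ → ℝ) (k l : Fin n) (h : (k : ℕ) < l) :
    ((bidiagonal n s).transpose * bidiagonal n s) k l =
      if (k : ℕ) + 1 = l then -s l ^ 2 else 0 := by
  obtain ⟨y, hy⟩ : ∃ y : ℕ → ℝ, ∀ i, y i =
      (if (l : ℕ) = i then s i else 0) + (if (l : ℕ) + 1 = i then -s i else 0) := ⟨_, fun _ => rfl⟩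
  have h1 : ((bidiagonal n s).transpose * bidiagonal n s) k l =
      (bidiagonal n s).transpose.mulVec (fun i => y i) k := by
    simp only [hy]
    rfl
  rw [h1, bidiagonal_transpose_mulVec, hy, hy]
  have hl := l.2
  by_cases h2 : (k : ℕ) + 1 = l
  · simp only [h2, hl, if_true]
    rw [if_neg (by omega : ¬ (l : ℕ) = k), if_neg (by omega : ¬ (l : ℕ) + 1 = k),
      if_neg (by omega)]
    ring
  · rw [if_neg (by omega : ¬ (l : ℕ) = k), if_neg (by omega : ¬ (l : ℕ) + 1 = k),
      if_neg (by omega : ¬ (l : ℕ) = k + 1), if_neg (by omega : ¬ (l : ℕ) + 1 = k + 1), if_neg h2]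
    simp

/-- The recursion computes the determinant of a pencil of tridiagonal matrices. -/
theorem det_pencil_eq_plumbingSeq (o e s : ℕ → ℝ) (w : ℝ) (n : ℕ)
    (hs : ∀ k < n, o k * s k ^ 2 = 1) :
    (w • Matrix.diagonal (fun i : Fin n => e i)
        + (bidiagonal n s).transpose * bidiagonal n s).det =
      (plumbingSeq o e w (0, 1) n).2 * ∏ i : Fin n, s i ^ 2 := by
  cases n with
  | zero => simp [plumbingSeq]
  | succ n =>
    set M := w • Matrix.diagonal (fun i : Fin (n + 1) => e i)
        + (bidiagonal (n + 1) s).transpose * bidiagonal (n + 1) s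
    set u : ℕ → ℝ := fun k => (plumbingSeq o e w (0, 1) k).1 with hu
    set v : ℕ → ℝ := fun k => (plumbingSeq o e w (0, 1) k).2 with hv
    have hu1 : ∀ k, u (k + 1) = u k + o k * v k := fun k => rfl
    have hv1 : ∀ k, v (k + 1) = v k + e k * w * u (k + 1) := fun k => rfl
    have hoff : ∀ i j : Fin (n + 1), (i : ℕ) < j →
        M i j = if (i : ℕ) + 1 = j then -s j ^ 2 else 0 := by
      intro i j hij
      have hne : i ≠ j := fun h => by simp [h] at hij
      rw [show M i j = (w • Matrix.diagonal (fun i : Fin (n + 1) => e i)) i j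
          + ((bidiagonal (n + 1) s).transpose * bidiagonal (n + 1) s) i j from rfl,
        bidiagonal_gram_apply _ _ _ _ hij, Matrix.smul_apply,
        Matrix.diagonal_apply_ne _ hne, smul_zero, zero_add]
    -- The bidiagonal matrix sends the vector of the `u (k + 1)` to `s k * o k * v k`; its transpose
    -- turns this into `v k - v (k + 1)`, without the second term in the last row. Adding `e k * w *
    -- u (k + 1) = v (k + 1) - v k` cancels everything except `v (n + 1)` in the last row.
    have hvec : ∀ i : Fin (n + 1), M.mulVec (fun j => u (j + 1)) i =
        v (i + 1) - if (i : ℕ) + 1 < n + 1 then v (i + 1) else 0 := by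
      intro i
      obtain ⟨z, hz⟩ : ∃ z : ℕ → ℝ, ∀ k, z k = s k * (o k * v k) := ⟨_, fun _ => rfl⟩
      have h1 : (bidiagonal (n + 1) s).mulVec (fun j => u (j + 1)) =
          fun j : Fin (n + 1) => z j := by
        funext j
        rw [bidiagonal_mulVec _ _ _ rfl, hu1, hz]
        ring
      have h2 : ∀ k < n + 1, s k * (s k * (o k * v k)) = v k := by
        intro k hk
        linear_combination v k * hs k hk
      rw [Matrix.add_mulVec, Pi.add_apply, Matrix.smul_mulVec, Pi.smul_apply,
        Matrix.mulVec_diagonal, ← Matrix.mulVec_mulVec, h1, bidiagonal_transpose_mulVec,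
        hz, hz, h2 i i.2]
      have h3 : (if (i : ℕ) + 1 < n + 1 then s (i + 1) * (s (i + 1) * (o (i + 1) * v (i + 1)))
          else 0) = if (i : ℕ) + 1 < n + 1 then v (i + 1) else 0 := by
        split_ifs with h
        · exact h2 _ h
        · rfl
      rw [h3, hv1 i, smul_eq_mul]
      ring
    have hdet := M.det_mul_of_hessenberg (fun i j hij => by
        rw [hoff i j (by omega), if_neg (by omega)]) (fun j => u (j + 1)) (fun i => by
        rw [hvec, if_pos (by simp), sub_self])
    have hprod : ∏ i : Fin n, M i.castSucc i.succ = (-1) ^ n * ∏ i : Fin n, s (i + 1) ^ 2 := by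
      have : ∀ i : Fin n, M i.castSucc i.succ = (-1) * s (i + 1) ^ 2 := by
        intro i
        rw [hoff _ _ (by simp), if_pos (by simp)]
        simp
      simp only [this, Finset.prod_mul_distrib]
      simp
    rw [hvec, if_neg (by simp), hprod] at hdet
    -- The Hessenberg identity carries this first coordinate as a factor; `o 0 * s 0 ^ 2 = 1` trades
    -- it for the missing factor `s 0 ^ 2`.
    have hu0 : u (((0 : Fin (n + 1)) : ℕ) + 1) = o 0 := by simp [hu, plumbingSeq]
    rw [hu0, Fin.val_last, sub_zero] at hdet
    rw [Fin.prod_univ_succ]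
    have h0 := hs 0 (by omega)
    have hsgn : ((-1 : ℝ) ^ n) * (-1) ^ n = 1 := by rw [← mul_pow]; simp
    simp only [Fin.val_zero, Fin.val_succ]
    linear_combination s 0 ^ 2 * hdet - M.det * h0
      + v (n + 1) * s 0 ^ 2 * (∏ i : Fin n, s (i + 1) ^ 2) * hsgn

/-- The polynomial computed by the recursion splits over the reals, and the signs of its zeros are
determined by those of the coefficients `e k`. -/
theorem exists_plumbingSeq_eq_prod (o e : ℕ → ℝ) (n : ℕ) (ho : ∀ k < n, 0 < o k)
    (he : ∀ k < n, e k ≠ 0) :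
    ∃ μ : Fin n → ℝ,
      (∀ w, (plumbingSeq o e w (0, 1) n).2 = ∏ i, (1 + w * μ i)) ∧
      (∀ i, μ i ≠ 0) ∧
      Fintype.card {i // 0 < μ i} = Fintype.card {i : Fin n // 0 < e i} ∧
      Fintype.card {i // μ i < 0} = Fintype.card {i : Fin n // e i < 0} := by
  -- Positivity of `o` enters here: it makes the scaling real, and hence the Gram matrix positive
  -- definite.
  let s : ℕ → ℝ := fun k => (√(o k))⁻¹
  have hs : ∀ k < n, o k * s k ^ 2 = 1 := by
    intro k hk
    have := (ho k hk).ne'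
    simp only [s, inv_pow, Real.sq_sqrt (ho k hk).le]
    field_simp
  have hs0 : ∀ k < n, s k ≠ 0 := fun k hk h => by simpa [h] using hs k hk
  have hprod : ∏ i : Fin n, s i ≠ 0 := Finset.prod_ne_zero_iff.2 fun i _ => hs0 i i.2
  obtain ⟨μ, hμ, hμ'⟩ := exists_det_pencil_eq_prod (bidiagonal n s)
    (by rw [det_bidiagonal]; exact hprod) (fun i => e i) (fun i => he i i.2)
  refine ⟨μ, fun w => ?_, hμ'⟩
  have h := hμ w
  rw [det_pencil_eq_plumbingSeq o e s w n hs, Matrix.det_mul, Matrix.det_transpose,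
    det_bidiagonal, Finset.prod_pow] at h
  have h2 : (∏ i : Fin n, s i) ^ 2 ≠ 0 := pow_ne_zero _ hprod
  apply mul_right_cancel₀ h2
  rw [h]
  ring

/-! ## Zeros of products of reciprocal quadratics -/

/-- The numerator of `1 + w * μ` for `w = (X - 1) ^ 2 / X`. -/
noncomputable def reciprocalQuadratic (μ : ℝ) : ℝ[X] :=
  Polynomial.C μ * (Polynomial.X - 1) ^ 2 + Polynomial.X

/-- Vieta's relations for `μ * X ^ 2 - (2 * μ - 1) * X + μ`. -/
theorem map_reciprocalQuadratic_eq (μ : ℝ) (α β : ℂ) (hprod : α * β = 1)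
    (hsum : μ * (α + β) = 2 * μ - 1) :
    (reciprocalQuadratic μ).map (algebraMap ℝ ℂ) =
      Polynomial.C (μ : ℂ) * ((Polynomial.X - Polynomial.C α) * (Polynomial.X - Polynomial.C β)) := by
  have h1 : (Polynomial.C α * Polynomial.C β : ℂ[X]) = 1 := by
    rw [← Polynomial.C_mul, hprod, Polynomial.C_1]
  have h2 : (Polynomial.C (μ : ℂ) * (Polynomial.C α + Polynomial.C β) : ℂ[X])
      = 2 * Polynomial.C (μ : ℂ) - 1 := by
    rw [← Polynomial.C_add, ← Polynomial.C_mul, hsum, Polynomial.C_sub, Polynomial.C_mul,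
      Polynomial.C_1, Polynomial.C_ofNat]
  simp only [reciprocalQuadratic, Polynomial.map_add, Polynomial.map_mul, Polynomial.map_pow,
    Polynomial.map_sub, Polynomial.map_C, Polynomial.map_X, Polynomial.map_one,
    Complex.coe_algebraMap]
  linear_combination -Polynomial.C (μ : ℂ) * h1 + Polynomial.X * h2

theorem aroots_reciprocalQuadratic (μ : ℝ) (hμ : μ ≠ 0) (α β : ℂ) (hprod : α * β = 1)
    (hsum : μ * (α + β) = 2 * μ - 1) :
    (reciprocalQuadratic μ).aroots ℂ = {α, β} := by
  rw [Polynomial.aroots, map_reciprocalQuadratic_eq μ α β hprod hsum,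
    Polynomial.roots_C_mul _ (by exact_mod_cast hμ), Polynomial.roots_mul, Polynomial.roots_X_sub_C,
    Polynomial.roots_X_sub_C]
  · rfl
  · exact mul_ne_zero (Polynomial.X_sub_C_ne_zero _) (Polynomial.X_sub_C_ne_zero _)

/-- The discriminant `1 - 4 * μ` is positive. Modulus 1 is excluded as well, so that these zeros do
not enter the other count. -/
theorem exists_aroots_of_neg (μ : ℝ) (hμ : μ < 0) :
    ∃ α β : ℂ, (reciprocalQuadratic μ).aroots ℂ = {α, β} ∧
      (α.im = 0 ∧ ‖α‖ ≠ 1) ∧ (β.im = 0 ∧ ‖β‖ ≠ 1) := by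
  set d := √(1 - 4 * μ)
  have hd : d ^ 2 = 1 - 4 * μ := Real.sq_sqrt (by linarith)
  have hμ0 : μ ≠ 0 := hμ.ne
  obtain ⟨x, hx⟩ : ∃ x : ℝ, x = (2 * μ - 1 + d) / (2 * μ) := ⟨_, rfl⟩
  obtain ⟨y, hy⟩ : ∃ y : ℝ, y = (2 * μ - 1 - d) / (2 * μ) := ⟨_, rfl⟩
  have hprod : x * y = 1 := by
    rw [hx, hy]
    field_simp
    linear_combination -hd
  have hsum : μ * (x + y) = 2 * μ - 1 := by
    rw [hx, hy]
    field_simp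
    ring
  -- A real zero of modulus 1 is `1`, which is never a zero, or `-1`, which forces `μ = 1 / 4`.
  have hne : ∀ x y : ℝ, x * y = 1 → μ * (x + y) = 2 * μ - 1 → ‖(x : ℂ)‖ ≠ 1 := by
    intro x y hprod hsum h
    rw [Complex.norm_real, Real.norm_eq_abs, abs_eq zero_le_one] at h
    rcases h with rfl | rfl
    · have : y = 1 := by linarith
      rw [this] at hsum
      linarith
    · have : y = -1 := by linarith
      rw [this] at hsum
      linarith
  refine ⟨x, y, aroots_reciprocalQuadratic μ hμ.ne _ _ (by exact_mod_cast hprod)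
    (by exact_mod_cast hsum), ⟨by simp, hne x y hprod hsum⟩, ⟨by simp, hne y x ?_ ?_⟩⟩
  · linarith
  · linarith

/-- The discriminant is negative, so the zeros are nonreal conjugates, and their product is 1. -/
theorem exists_aroots_of_quarter_lt (μ : ℝ) (hμ : 1 / 4 < μ) :
    ∃ α β : ℂ, (reciprocalQuadratic μ).aroots ℂ = {α, β} ∧
      (α.im ≠ 0 ∧ ‖α‖ = 1) ∧ (β.im ≠ 0 ∧ ‖β‖ = 1) := by
  set d := √(4 * μ - 1)
  have hd : d ^ 2 = 4 * μ - 1 := Real.sq_sqrt (by linarith)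
  have hd0 : d ≠ 0 := fun h => by rw [h] at hd; linarith
  have hμ0 : μ ≠ 0 := by linarith
  obtain ⟨x, hx⟩ : ∃ x : ℝ, x = (2 * μ - 1) / (2 * μ) := ⟨_, rfl⟩
  obtain ⟨y, hy⟩ : ∃ y : ℝ, y = d / (2 * μ) := ⟨_, rfl⟩
  have hy0 : y ≠ 0 := by rw [hy]; positivity
  have hnorm : x ^ 2 + y ^ 2 = 1 := by
    rw [hx, hy]
    field_simp
    linear_combination hd
  have hsum : μ * (2 * x) = 2 * μ - 1 := by
    rw [hx]
    field_simp
  have hn : ∀ y : ℝ, x ^ 2 + y ^ 2 = 1 → ‖(⟨x, y⟩ : ℂ)‖ = 1 := by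
    intro y h
    rw [← sq_eq_sq₀ (norm_nonneg _) zero_le_one, Complex.sq_norm, Complex.normSq_mk]
    linarith
  refine ⟨⟨x, y⟩, ⟨x, -y⟩, aroots_reciprocalQuadratic μ hμ0 _ _ ?_ ?_,
    ⟨hy0, hn y hnorm⟩, ⟨neg_ne_zero.2 hy0, hn (-y) (by linarith [neg_sq y])⟩⟩
  · apply Complex.ext
    · simp; linarith
    · simp; ring
  · apply Complex.ext
    · simp; linarith
    · simp

theorem reciprocalQuadratic_ne_zero (μ : ℝ) : reciprocalQuadratic μ ≠ 0 := by
  intro h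
  have := congrArg (Polynomial.eval 1) h
  simp [reciprocalQuadratic] at this

theorem aroots_C_mul_prod_reciprocalQuadratic {n : ℕ} (c : ℝ) (hc : c ≠ 0) (μ : Fin n → ℝ) :
    (Polynomial.C c * ∏ i, reciprocalQuadratic (μ i)).aroots ℂ =
      ∑ i, (reciprocalQuadratic (μ i)).aroots ℂ := by
  rw [Polynomial.aroots_C_mul _ hc, Polynomial.aroots, Polynomial.map_prod, Polynomial.roots_prod]
  · rfl
  · rw [Finset.prod_ne_zero_iff]
    exact fun i _ => (Polynomial.map_ne_zero_iff (algebraMap ℝ ℂ).injective).2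
      (reciprocalQuadratic_ne_zero _)

theorem countP_aroots_C_mul_prod {n : ℕ} (c : ℝ) (hc : c ≠ 0) (μ : Fin n → ℝ) (p : ℂ → Prop)
    [DecidablePred p] (q : ℝ → Prop) [DecidablePred q]
    (h : ∀ i, ∃ α β : ℂ, (reciprocalQuadratic (μ i)).aroots ℂ = {α, β} ∧
      (p α ↔ q (μ i)) ∧ (p β ↔ q (μ i))) :
    ((Polynomial.C c * ∏ i, reciprocalQuadratic (μ i)).aroots ℂ).countP p =
      2 * Fintype.card {i // q (μ i)} := by
  rw [aroots_C_mul_prod_reciprocalQuadratic c hc μ, ← Multiset.coe_countPAddMonoidHom, map_sum,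
    Fintype.card_subtype, Finset.card_filter, Finset.mul_sum]
  refine Finset.sum_congr rfl fun i _ => ?_
  obtain ⟨α, β, h1, h2, h3⟩ := h i
  rw [h1, Multiset.coe_countPAddMonoidHom, Multiset.insert_eq_cons, ← Multiset.cons_zero,
    Multiset.countP_cons, Multiset.countP_cons, Multiset.countP_zero]
  by_cases hq : q (μ i) <;> simp [h2, h3, hq]

/-- Zeros of a product of reciprocal quadratics whose parameters avoid `[0, 1 / 4]`. -/
theorem zeros_C_mul_prod_reciprocalQuadratic {n : ℕ} (c : ℝ) (hc : c ≠ 0) (μ : Fin n → ℝ)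
    (hμ : ∀ i, μ i < 0 ∨ 1 / 4 < μ i) :
    IsBiStable (Polynomial.C c * ∏ i, reciprocalQuadratic (μ i)) ∧
      numRealZeros (Polynomial.C c * ∏ i, reciprocalQuadratic (μ i)) =
        2 * Fintype.card {i // μ i < 0} ∧
      numUnitZeros (Polynomial.C c * ∏ i, reciprocalQuadratic (μ i)) =
        2 * Fintype.card {i // 0 < μ i} := by
  classical
  have hroots : ∀ i, ∃ α β : ℂ, (reciprocalQuadratic (μ i)).aroots ℂ = {α, β} ∧
      ((α.im = 0 ↔ μ i < 0) ∧ (‖α‖ = 1 ↔ 0 < μ i)) ∧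
      ((β.im = 0 ↔ μ i < 0) ∧ (‖β‖ = 1 ↔ 0 < μ i)) := by
    intro i
    rcases hμ i with h | h
    · obtain ⟨α, β, h1, h2, h3⟩ := exists_aroots_of_neg _ h
      have := h.le.not_gt
      exact ⟨α, β, h1, by simp [h, h2, this], by simp [h, h3, this]⟩
    · obtain ⟨α, β, h1, h2, h3⟩ := exists_aroots_of_quarter_lt _ h
      have h4 : 0 < μ i := by linarith
      have := h4.le.not_gt
      exact ⟨α, β, h1, by simp [h4, h2, this], by simp [h4, h3, this]⟩
  refine ⟨fun z hz => ?_, ?_, ?_⟩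
  · have hne : Polynomial.C c * ∏ i, reciprocalQuadratic (μ i) ≠ 0 :=
      mul_ne_zero (Polynomial.C_ne_zero.2 hc)
        (Finset.prod_ne_zero_iff.2 fun i _ => reciprocalQuadratic_ne_zero _)
    have hz' := (Polynomial.mem_aroots.2 ⟨hne, hz⟩)
    rw [aroots_C_mul_prod_reciprocalQuadratic c hc μ, Multiset.mem_sum] at hz'
    obtain ⟨i, -, hi⟩ := hz'
    obtain ⟨α, β, h1, ⟨h2, h3⟩, h4, h5⟩ := hroots i
    rw [h1] at hi
    have hi' : z = α ∨ z = β := by simpa using hi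
    have hcase : μ i < 0 ∨ 0 < μ i := (hμ i).imp_right fun h => by linarith
    rcases hi' with rfl | rfl
    · rwa [h2, h3]
    · rwa [h4, h5]
  · refine countP_aroots_C_mul_prod c hc μ _ (fun x => x < 0) fun i => ?_
    obtain ⟨α, β, h1, h2, h3⟩ := hroots i
    exact ⟨α, β, h1, h2.1, h3.1⟩
  · refine countP_aroots_C_mul_prod c hc μ _ (fun x => 0 < x) fun i => ?_
    obtain ⟨α, β, h1, h2, h3⟩ := hroots i
    exact ⟨α, β, h1, h2.2, h3.2⟩

/-! ## Colourings of plats -/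

/-- The left-hand side of the Alexander relation of a crossing. -/
def Crossing.defect (t : ℝ) (x : Crossing) (φ : ℕ → ℝ) : ℝ :=
  (1 - t) * φ x.overArc - φ x.leftArc + t * φ x.rightArc

theorem Crossing.sum_aeval_row (t : ℝ) (x : Crossing) (φ : ℕ → ℝ) (N : ℕ) (h1 : x.overArc < N)
    (h2 : x.leftArc < N) (h3 : x.rightArc < N) :
    ∑ j ∈ Finset.range N, Polynomial.aeval t (x.row j) * φ j = x.defect t φ := by
  simp only [Crossing.row, map_add, apply_ite (Polynomial.aeval t), add_mul, ite_mul,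
    Finset.sum_add_distrib, map_zero, zero_mul, Finset.sum_ite_eq', Finset.mem_range,
    h1, h2, h3, if_true]
  simp [Crossing.defect, sub_eq_add_neg]

theorem sum_aeval_joinRow (t : ℝ) (a : ℕ × ℕ) (φ : ℕ → ℝ) (N : ℕ) (h1 : a.1 < N) (h2 : a.2 < N) :
    ∑ j ∈ Finset.range N, Polynomial.aeval t (joinRow a j) * φ j = φ a.1 - φ a.2 := by
  simp only [joinRow, map_add, apply_ite (Polynomial.aeval t), add_mul, ite_mul,
    Finset.sum_add_distrib, map_zero, zero_mul, Finset.sum_ite_eq', Finset.mem_range,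
    h1, h2, if_true]
  simp [sub_eq_add_neg]

/-- The colour of the arc that starts at a crossing, for given colours and orientations of the
strands above it. -/
noncomputable def BraidLetter.newColor (t : ℝ) (x : BraidLetter) (s : Fin 4 → ℝ × Bool) : ℝ :=
  let i := x.pos.castSucc
  let j := x.pos.succ
  if x.leftOver then
    if (s i).2 then ((s j).1 - (1 - t) * (s i).1) / t else (1 - t) * (s i).1 + t * (s j).1
  else
    if (s j).2 then (1 - t) * (s j).1 + t * (s i).1 else ((s i).1 - (1 - t) * (s j).1) / t

/-- The colours and orientations of the strands below a crossing. -/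
noncomputable def BraidLetter.colorStep (t : ℝ) (s : Fin 4 → ℝ × Bool) (x : BraidLetter) :
    Fin 4 → ℝ × Bool :=
  let i := x.pos.castSucc
  let j := x.pos.succ
  if x.leftOver then
    Function.update (Function.update s j (s i)) i (x.newColor t s, (s j).2)
  else
    Function.update (Function.update s i (s j)) j (x.newColor t s, (s i).2)

/-- The colours and orientations of the strands of a section. -/
def Section.color (s : Section) (φ : ℕ → ℝ) (i : Fin 4) : ℝ × Bool :=
  (φ (s i).1, (s i).2)

/-- The extension of a colouring of the arcs above a braid word to all arcs. -/
noncomputable def extendColoring (t : ℝ) :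
    List BraidLetter → Section → ℕ → (ℕ → ℝ) → ℕ → ℝ
  | [], _, _, φ => φ
  | x :: w, s, n, φ =>
    extendColoring t w (x.step s n) (n + 1) (Function.update φ n (x.newColor t (s.color φ)))

theorem extendColoring_of_lt (t : ℝ) (w : List BraidLetter) (s : Section) (n : ℕ) (φ : ℕ → ℝ)
    (k : ℕ) (hk : k < n) : extendColoring t w s n φ k = φ k := by
  induction w generalizing s n φ with
  | nil => rfl
  | cons x w ih =>
    rw [extendColoring, ih _ _ _ (by omega), Function.update_of_ne (by omega)]

theorem BraidLetter.step_lt (x : BraidLetter) (s : Section) (n : ℕ) (hs : ∀ i, (s i).1 < n)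
    (i : Fin 4) : (x.step s n i).1 < n + 1 := by
  have h : ∀ i, (s i).1 < n + 1 := fun i => (hs i).trans (Nat.lt_succ_self n)
  simp only [BraidLetter.step]
  split_ifs <;> simp only [Function.update_apply] <;> split_ifs <;> simp [h]

theorem BraidLetter.color_step (t : ℝ) (x : BraidLetter) (s : Section) (n : ℕ)
    (hs : ∀ i, (s i).1 < n) (φ : ℕ → ℝ) :
    (x.step s n).color (Function.update φ n (x.newColor t (s.color φ))) =
      BraidLetter.colorStep t (s.color φ) x := by
  have h : ∀ i, (s i).1 ≠ n := fun i => (hs i).ne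
  funext i
  simp only [BraidLetter.step, BraidLetter.colorStep, Section.color]
  split_ifs <;> simp only [Function.update_apply] <;> split_ifs <;>
    simp_all [Section.color]

theorem braidBottom_lt (w : List BraidLetter) (s : Section) (n : ℕ) (hs : ∀ i, (s i).1 < n)
    (i : Fin 4) : (braidBottom w s n i).1 < n + w.length := by
  induction w generalizing s n with
  | nil => exact hs i
  | cons x w ih =>
    have := ih (x.step s n) (n + 1) (x.step_lt s n hs)
    rw [braidBottom, List.length_cons]
    omega

theorem color_braidBottom (t : ℝ) (w : List BraidLetter) (s : Section) (n : ℕ)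
    (hs : ∀ i, (s i).1 < n) (φ : ℕ → ℝ) :
    (braidBottom w s n).color (extendColoring t w s n φ) =
      w.foldl (BraidLetter.colorStep t) (s.color φ) := by
  induction w generalizing s n φ with
  | nil => rfl
  | cons x w ih =>
    rw [braidBottom, extendColoring, ih _ _ (x.step_lt s n hs), x.color_step t s n hs,
      List.foldl_cons]

theorem length_braidCrossings (w : List BraidLetter) (s : Section) (n : ℕ) :
    (braidCrossings w s n).length = w.length := by
  induction w generalizing s n with
  | nil => rfl
  | cons x w ih => simp [braidCrossings, ih]

/-- The crossing `x` is the one at which the arc `n` starts; the other arcs are older. -/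
def Crossing.IsNew (x : Crossing) (n : ℕ) : Prop :=
  x.overArc < n ∧ (x.leftArc < n ∧ x.rightArc = n ∨ x.leftArc = n ∧ x.rightArc < n)

theorem BraidLetter.crossing_isNew (x : BraidLetter) (s : Section) (n : ℕ)
    (hs : ∀ i, (s i).1 < n) : (x.crossing s n).IsNew n := by
  simp only [BraidLetter.crossing]
  split_ifs <;> simp [Crossing.IsNew, hs]

/-- `newColor` is the solution of the Alexander relation for the new arc; solving requires division
by `t` when that arc lies on the right. -/
theorem BraidLetter.defect_crossing (t : ℝ) (ht : t ≠ 0) (x : BraidLetter) (s : Section) (n : ℕ)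
    (φ ψ : ℕ → ℝ) (hψ : ∀ i, ψ (s i).1 = φ (s i).1)
    (hn : ψ n = x.newColor t (s.color φ)) : (x.crossing s n).defect t ψ = 0 := by
  simp only [BraidLetter.newColor, Section.color] at hn
  simp only [BraidLetter.crossing]
  by_cases h1 : x.leftOver
  · by_cases h2 : (s x.pos.castSucc).2 <;>
      (simp only [h1, h2, if_true] at hn ⊢
       simp [Crossing.defect, hψ, hn] <;> field_simp <;> ring)
  · by_cases h2 : (s x.pos.succ).2 <;>
      (simp only [h1, h2, if_true] at hn ⊢
       simp [Crossing.defect, hψ, hn] <;> field_simp <;> ring)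

/-- This makes the Alexander matrix lower Hessenberg with units on the superdiagonal. -/
theorem braidCrossings_isNew (w : List BraidLetter) (s : Section) (n : ℕ)
    (hs : ∀ i, (s i).1 < n) (k : ℕ) (hk : k < (braidCrossings w s n).length) :
    (braidCrossings w s n)[k].IsNew (n + k) := by
  induction w generalizing s n k with
  | nil => simp [braidCrossings] at hk
  | cons x w ih =>
    cases k with
    | zero => exact x.crossing_isNew s n hs
    | succ k =>
      have := ih (x.step s n) (n + 1) (x.step_lt s n hs) k (by simpa [braidCrossings] using hk)
      rwa [show n + 1 + k = n + (k + 1) by omega] at this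

theorem defect_braidCrossings (t : ℝ) (ht : t ≠ 0) (w : List BraidLetter) (s : Section) (n : ℕ)
    (hs : ∀ i, (s i).1 < n) (φ : ℕ → ℝ) (k : ℕ) (hk : k < (braidCrossings w s n).length) :
    (braidCrossings w s n)[k].defect t (extendColoring t w s n φ) = 0 := by
  induction w generalizing s n φ k with
  | nil => simp [braidCrossings] at hk
  | cons x w ih =>
    cases k with
    | zero =>
      refine x.defect_crossing t ht s n φ _ (fun i => ?_) ?_
      · exact extendColoring_of_lt _ _ _ _ _ _ (hs i)
      · rw [extendColoring, extendColoring_of_lt _ _ _ _ _ _ (Nat.lt_succ_self n),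
          Function.update_self]
    | succ k =>
      exact ih (x.step s n) (n + 1) (x.step_lt s n hs) _ k (by simpa [braidCrossings] using hk)

/-! ## Colours below twists -/

/-- Four strands that are oriented down, up, down, up. -/
def platColors (p q r z : ℝ) : Fin 4 → ℝ × Bool :=
  ![(p, true), (q, false), (r, true), (z, false)]

/-- A full twist of antiparallel strands preserves the difference `r - q`, so iterating it only
repeats the same shift. On the left pair the orientations are interchanged, which replaces `t` by `1
/ t`. -/
theorem colorStep_middle (t : ℝ) (ht : t ≠ 0) (b : Bool) (p q r z : ℝ) :
    BraidLetter.colorStep t (BraidLetter.colorStep t (platColors p q r z) ⟨1, b⟩) ⟨1, b⟩ =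
      platColors p (q + (if b then 1 else -1) * ((t - 1) * (r - q)))
        (r + (if b then 1 else -1) * ((t - 1) * (r - q))) z := by
  have h1 : (1 : Fin 3).castSucc = (1 : Fin 4) := rfl
  have h2 : (1 : Fin 3).succ = (2 : Fin 4) := rfl
  funext i
  cases b <;> fin_cases i <;>
    simp [BraidLetter.colorStep, BraidLetter.newColor, platColors, h1, h2] <;> field_simp <;> ring

theorem colorStep_left (t : ℝ) (ht : t ≠ 0) (b : Bool) (p q r z : ℝ) :
    BraidLetter.colorStep t (BraidLetter.colorStep t (platColors p q r z) ⟨0, b⟩) ⟨0, b⟩ =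
      platColors (p + (if b then 1 else -1) * ((1 / t - 1) * (q - p)))
        (q + (if b then 1 else -1) * ((1 / t - 1) * (q - p))) r z := by
  have h1 : (0 : Fin 3).castSucc = (0 : Fin 4) := rfl
  have h2 : (0 : Fin 3).succ = (1 : Fin 4) := rfl
  funext i
  cases b <;> fin_cases i <;>
    simp [BraidLetter.colorStep, BraidLetter.newColor, platColors, h1, h2] <;> field_simp <;> ring

theorem natAbs_mul_sign_eq (a : ℤ) :
    (a.natAbs : ℝ) * (if decide (0 < a) then 1 else -1) = a := by
  rcases lt_or_ge 0 a with h | h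
  · have : (a.natAbs : ℤ) = a := by omega
    have h2 : (a.natAbs : ℝ) = a := by rw [← Int.cast_natCast, this]
    simp [h, h2]
  · have : (a.natAbs : ℤ) = -a := by omega
    have h2 : (a.natAbs : ℝ) = -a := by rw [← Int.cast_natCast, this, Int.cast_neg]
    simp [h.not_gt, h2]

theorem foldl_replicate_middle (t : ℝ) (ht : t ≠ 0) (b : Bool) (k : ℕ) (p q r z : ℝ) :
    (List.replicate (2 * k) (⟨1, b⟩ : BraidLetter)).foldl (BraidLetter.colorStep t)
        (platColors p q r z) =
      platColors p (q + k * (if b then 1 else -1) * ((t - 1) * (r - q)))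
        (r + k * (if b then 1 else -1) * ((t - 1) * (r - q))) z := by
  induction k generalizing q r with
  | zero => simp
  | succ k ih =>
    rw [show 2 * (k + 1) = 2 * k + 1 + 1 by ring, List.replicate_succ, List.replicate_succ,
      List.foldl_cons, List.foldl_cons, colorStep_middle t ht, ih]
    push_cast
    congr 1 <;> ring

theorem foldl_replicate_left (t : ℝ) (ht : t ≠ 0) (b : Bool) (k : ℕ) (p q r z : ℝ) :
    (List.replicate (2 * k) (⟨0, b⟩ : BraidLetter)).foldl (BraidLetter.colorStep t)
        (platColors p q r z) =
      platColors (p + k * (if b then 1 else -1) * ((1 / t - 1) * (q - p)))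
        (q + k * (if b then 1 else -1) * ((1 / t - 1) * (q - p))) r z := by
  induction k generalizing p q with
  | zero => simp
  | succ k ih =>
    rw [show 2 * (k + 1) = 2 * k + 1 + 1 by ring, List.replicate_succ, List.replicate_succ,
      List.foldl_cons, List.foldl_cons, colorStep_left t ht, ih]
    push_cast
    congr 1 <;> ring

/-- The coordinates are `u = (q - p) / (t - 1)` and `v = r - q`, stated without division so that `t
= 1` is allowed. The shift `(1 / t - 1) * (t - 1) * u` of the left pair changes `v` by `(t - 1) ^ 2
/ t * u` per full twist. Only differences matter, so the leftmost colour `p'` stays unspecified. -/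
theorem foldl_twistWord (t : ℝ) (ht : t ≠ 0) (n : ℕ) (c : List ℤ) (hc : c.length = 2 * n)
    (p u v z : ℝ) :
    ∃ p' : ℝ, (twistWord true c).foldl (BraidLetter.colorStep t)
        (platColors p (p + (t - 1) * u) (p + (t - 1) * u + v) z) =
      platColors p' (p' + (t - 1) * (plumbingSeq (fun k => c.getD (2 * k) 0)
          (fun k => c.getD (2 * k + 1) 0) ((t - 1) ^ 2 / t) (u, v) n).1)
        (p' + (t - 1) * (plumbingSeq (fun k => c.getD (2 * k) 0)
          (fun k => c.getD (2 * k + 1) 0) ((t - 1) ^ 2 / t) (u, v) n).1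
          + (plumbingSeq (fun k => c.getD (2 * k) 0)
          (fun k => c.getD (2 * k + 1) 0) ((t - 1) ^ 2 / t) (u, v) n).2) z := by
  induction n generalizing c p u v with
  | zero =>
    obtain rfl : c = [] := List.length_eq_zero_iff.1 (by omega)
    exact ⟨p, rfl⟩
  | succ n ih =>
    match c, hc with
    | a :: b :: c, hc =>
      obtain ⟨p', hp'⟩ := ih c (by simpa [mul_add] using hc)
        (p + b * ((1 / t - 1) * ((t - 1) * (u + a * v)))) (u + a * v)
        (v + b * ((t - 1) ^ 2 / t) * (u + a * v))
      refine ⟨p', ?_⟩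
      rw [plumbingSeq_succ_eq_shift]
      simp only [twistWord, List.foldl_append, if_true, Bool.not_true, Bool.not_false,
        Bool.false_eq_true, if_false]
      rw [foldl_replicate_middle t ht, foldl_replicate_left t ht, natAbs_mul_sign_eq,
        natAbs_mul_sign_eq]
      have e1 : ∀ k, (a :: b :: c).getD (2 * (k + 1)) 0 = c.getD (2 * k) 0 := fun k => rfl
      have e2 : ∀ k, (a :: b :: c).getD (2 * (k + 1) + 1) 0 = c.getD (2 * k + 1) 0 := fun k => rfl
      have e3 : (a :: b :: c).getD (2 * 0) 0 = a := rfl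
      have e4 : (a :: b :: c).getD (2 * 0 + 1) 0 = b := rfl
      simp only [e1, e2, e3, e4]
      rw [← hp']
      congr 2 <;> field_simp <;> ring

/-! ## The Alexander polynomial of a plat -/

/-- The entry of an Alexander row at the arc that starts at the crossing is a unit. -/
theorem Crossing.row_isNew (x : Crossing) (n : ℕ) (hx : x.IsNew n) :
    x.row n = -1 ∨ x.row n = Polynomial.X := by
  obtain ⟨h1, ⟨h2, h3⟩ | ⟨h2, h3⟩⟩ := hx
  · right; simp [Crossing.row, h1.ne', h2.ne', h3]
  · left; simp [Crossing.row, h1.ne', h2, h3.ne']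

theorem Crossing.row_eq_zero (x : Crossing) (n j : ℕ) (hx : x.IsNew n) (hj : n < j) :
    x.row j = 0 := by
  obtain ⟨h1, h2⟩ := hx
  simp only [Crossing.row]
  rw [if_neg (by omega), if_neg (by omega), if_neg (by omega)]
  simp

theorem exists_prod_eq_pow {ι : Type*} (s : Finset ι) (f : ι → ℤ[X])
    (hf : ∀ i ∈ s, f i = -1 ∨ f i = Polynomial.X) :
    ∃ a b : ℕ, ∏ i ∈ s, f i = (-1) ^ a * Polynomial.X ^ b := by
  classical
  induction s using Finset.induction_on with
  | empty => exact ⟨0, 0, by simp⟩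
  | insert i s hi ih =>
    obtain ⟨a, b, h⟩ := ih fun j hj => hf j (Finset.mem_insert_of_mem hj)
    rw [Finset.prod_insert hi, h]
    rcases hf i (Finset.mem_insert_self _ _) with h1 | h1
    · exact ⟨a + 1, b, by rw [h1]; ring⟩
    · exact ⟨a, b + 1, by rw [h1]; ring⟩

theorem platTop_lt (i : Fin 4) : (platTop i).1 < 2 := by
  fin_cases i <;> simp [platTop]

/-- The reduced Alexander determinant of a plat, up to a unit. -/
theorem exists_aeval_det_platDiagram (c : List ℤ) (n : ℕ) (hc : c.length = 2 * n) :
    ∃ a b : ℕ, ∀ t : ℝ, t ≠ 0 →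
      Polynomial.aeval t (platDiagram c).reducedAlexanderMatrix.det =
        (-1) ^ a * t ^ b * (plumbingSeq (fun k => c.getD (2 * k) 0)
          (fun k => c.getD (2 * k + 1) 0) ((t - 1) ^ 2 / t) (0, 1) n).2 := by
  set w := twistWord true c with hw
  set D := platDiagram c
  have hcr : D.crossings = braidCrossings w platTop 2 := rfl
  have hlen : D.crossings.length = w.length := length_braidCrossings _ _ _
  have hjoins : D.joins = [((braidBottom w platTop 2 1).1, (braidBottom w platTop 2 2).1),
      ((braidBottom w platTop 2 0).1, (braidBottom w platTop 2 3).1)] :=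
    if_pos (hc ▸ even_two_mul n)
  -- Column `j` belongs to arc `j + 1`, and crossing `i` creates arc `i + 2`, so the new arcs occupy
  -- the superdiagonal.
  let M : Matrix (Fin (w.length + 1)) (Fin (w.length + 1)) ℤ[X] :=
    Matrix.of fun i j => (D.rows.getD i 0) (j + 1)
  have hM : D.reducedAlexanderMatrix.det = M.det := rfl
  have hrow : ∀ k (hk : k < D.crossings.length), D.rows.getD k 0 = D.crossings[k].row := by
    intro k hk
    rw [LinkDiagram.rows, List.getD_append _ _ _ _ (by simpa using hk),
      List.getD_eq_getElem _ _ (by simpa using hk), List.getElem_map]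
  have hlast : D.rows.getD w.length 0 =
      joinRow ((braidBottom w platTop 2 1).1, (braidBottom w platTop 2 2).1) := by
    rw [LinkDiagram.rows, List.getD_append_right _ _ _ _ (by simp [hlen])]
    simp [hlen, hjoins]
  have hnew : ∀ k (hk : k < D.crossings.length), (D.crossings[k]).IsNew (2 + k) :=
    fun k hk => braidCrossings_isNew w platTop 2 platTop_lt k hk
  have hunit : ∀ i : Fin w.length, M i.castSucc i.succ = -1 ∨ M i.castSucc i.succ =
      Polynomial.X := by
    intro i
    have hi : (i : ℕ) < D.crossings.length := i.2.trans_eq hlen.symm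
    have h1 : M i.castSucc i.succ = (D.crossings[(i : ℕ)]).row (2 + i) := by
      rw [← hrow i hi, add_comm]
      rfl
    rw [h1]
    exact Crossing.row_isNew _ _ (hnew i hi)
  obtain ⟨a, b, hab⟩ := exists_prod_eq_pow Finset.univ (fun i : Fin w.length =>
    M i.castSucc i.succ) fun i _ => hunit i
  -- The sign collects `w.length` from the Hessenberg identity, one from the closing row, which
  -- evaluates to `-v`, and `a` from the superdiagonal.
  refine ⟨w.length + 1 + a, b, fun t ht => ?_⟩
  -- Colour 0 on arc 0 makes deleting its column harmless; colour 1 on arc 1 makes the factor `x 0`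
  -- of the Hessenberg identity equal to 1.
  let φ₀ : ℕ → ℝ := fun k => if k = 0 then 0 else 1
  let φ := extendColoring t w platTop 2 φ₀
  have hφ0 : φ 0 = 0 := extendColoring_of_lt _ _ _ _ _ _ (by omega)
  have hφ1 : φ 1 = 1 := extendColoring_of_lt _ _ _ _ _ _ (by omega)
  let N := M.map (Polynomial.aeval t : ℤ[X] →ₐ[ℤ] ℝ)
  have hN : Polynomial.aeval t M.det = N.det := (Polynomial.aeval t : ℤ[X] →ₐ[ℤ] ℝ).map_det M
  have hNvec : ∀ i : Fin (w.length + 1), N.mulVec (fun j => φ (j + 1)) i =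
      ∑ j ∈ Finset.range (w.length + 2), Polynomial.aeval t (D.rows.getD i 0 j) * φ j := by
    intro i
    rw [Finset.sum_range_succ', hφ0, mul_zero, add_zero, ← Fin.sum_univ_eq_sum_range
      (fun j => Polynomial.aeval t (D.rows.getD i 0 (j + 1)) * φ (j + 1))]
    rfl
  have hx : ∀ i : Fin w.length, N.mulVec (fun j => φ (j + 1)) i.castSucc = 0 := by
    intro i
    have hi : (i : ℕ) < D.crossings.length := i.2.trans_eq hlen.symm
    obtain ⟨h1, h2⟩ := hnew i hi
    have hi2 := i.2
    rw [hNvec, Fin.val_castSucc, hrow i hi, Crossing.sum_aeval_row _ _ _ _ (by omega) (by omega)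
      (by omega)]
    exact defect_braidCrossings t ht w platTop 2 platTop_lt φ₀ i hi
  have hess : ∀ i j : Fin (w.length + 1), (i : ℕ) + 1 < j → N i j = 0 := by
    intro i j hij
    have hj := j.2
    have hi : (i : ℕ) < D.crossings.length := by omega
    have h1 : N i j = Polynomial.aeval t ((D.crossings[(i : ℕ)]).row (j + 1)) := by
      rw [← hrow i hi]
      rfl
    rw [h1, Crossing.row_eq_zero _ _ _ (hnew i hi) (by omega), map_zero]
  have hdet := N.det_mul_of_hessenberg hess (fun j => φ (j + 1)) hx
  have hprod : ∏ i : Fin w.length, N i.castSucc i.succ = (-1) ^ a * t ^ b := by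
    have h1 : ∏ i : Fin w.length, N i.castSucc i.succ =
        Polynomial.aeval t (∏ i : Fin w.length, M i.castSucc i.succ) := by
      rw [map_prod]
      rfl
    rw [h1, hab]
    simp
  have hbot : ∀ i, (braidBottom w platTop 2 i).1 < w.length + 2 := fun i => by
    rw [add_comm]
    exact braidBottom_lt w platTop 2 platTop_lt i
  rw [hprod, hNvec, Fin.val_last, hlast, sum_aeval_joinRow _ _ _ _ (hbot 1) (hbot 2)] at hdet
  obtain ⟨p, hp⟩ := foldl_twistWord t ht n c hc 0 0 1 1
  have htop : Section.color platTop φ₀ =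
      platColors 0 (0 + (t - 1) * 0) (0 + (t - 1) * 0 + 1) 1 := by
    funext i
    fin_cases i <;> simp [Section.color, platTop, φ₀, platColors]
  have hcol := color_braidBottom t w platTop 2 platTop_lt φ₀
  rw [htop, hp] at hcol
  have hc1 : φ (braidBottom w platTop 2 1).1 = _ := congrArg Prod.fst (congrFun hcol 1)
  have hc2 : φ (braidBottom w platTop 2 2).1 = _ := congrArg Prod.fst (congrFun hcol 2)
  have hdet' : N.det * φ 1 = _ := hdet
  rw [hc1, hc2, hφ1, mul_one] at hdet'
  rw [hM, hN, hdet']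
  simp only [platColors, Matrix.cons_val]
  ring

/-- Normalization of a polynomial that is associated, up to powers of the variable, to a
polynomial with nonzero constant term. -/
theorem exists_map_normalizeUnit_eq (f : ℤ[X]) (g : ℝ[X]) (hg : g.coeff 0 ≠ 0) (c : ℝ)
    (hc : c ≠ 0) (a b : ℕ)
    (h : Polynomial.X ^ a * f.map (Int.castRingHom ℝ) =
      Polynomial.C c * (Polynomial.X ^ b * g)) :
    ∃ d : ℝ, d ≠ 0 ∧ (normalizeUnit f).map (Int.castRingHom ℝ) = Polynomial.C d * g := by
  have hg0 : g ≠ 0 := fun h0 => hg (by simp [h0])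
  have hf : f ≠ 0 := by
    rintro rfl
    rw [Polynomial.map_zero, mul_zero] at h
    exact mul_ne_zero (Polynomial.C_ne_zero.2 hc)
      (mul_ne_zero (pow_ne_zero _ Polynomial.X_ne_zero) hg0) h.symm
  set k := f.natTrailingDegree with hk
  obtain ⟨q, hq⟩ : Polynomial.X ^ k ∣ f :=
    Polynomial.X_pow_dvd_iff.2 fun d hd => Polynomial.coeff_eq_zero_of_lt_natTrailingDegree hd
  have hq0 : (q.map (Int.castRingHom ℝ)).coeff 0 ≠ 0 := by
    have h1 : f.coeff k ≠ 0 := Polynomial.coeff_natTrailingDegree_ne_zero.2 hf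
    have h2 : f.coeff k = q.coeff 0 := by
      conv_lhs => rw [hq]
      rw [Polynomial.coeff_X_pow_mul', if_pos le_rfl, Nat.sub_self]
    rw [Polynomial.coeff_map]
    simpa [← h2] using h1
  have hdiv : f /ₘ Polynomial.X ^ k = q := by
    conv_lhs => rw [hq]
    exact Polynomial.mul_divByMonic_cancel_left _ (Polynomial.monic_X_pow k)
  have h' : Polynomial.X ^ (a + k) * q.map (Int.castRingHom ℝ) =
      Polynomial.X ^ b * (Polynomial.C c * g) := by
    rw [hq] at h
    rw [Polynomial.map_mul, Polynomial.map_pow, Polynomial.map_X] at h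
    rw [pow_add, mul_assoc, h]
    ring
  -- Both cofactors have nonzero constant term, so the lowest exponents on the two sides agree.
  have hab : a + k = b := by
    have h1 := congrArg Polynomial.natTrailingDegree h'
    have hq1 : q.map (Int.castRingHom ℝ) ≠ 0 := fun h0 => hq0 (by simp [h0])
    have hg1 : Polynomial.C c * g ≠ 0 := mul_ne_zero (Polynomial.C_ne_zero.2 hc) hg0
    have hg2 : (Polynomial.C c * g).coeff 0 ≠ 0 := by
      rw [Polynomial.coeff_C_mul]
      exact mul_ne_zero hc hg
    rw [mul_comm, Polynomial.natTrailingDegree_mul_X_pow hq1, mul_comm (Polynomial.X ^ b),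
      Polynomial.natTrailingDegree_mul_X_pow hg1,
      Polynomial.natTrailingDegree_eq_zero.2 (Or.inr hq0),
      Polynomial.natTrailingDegree_eq_zero.2 (Or.inr hg2)] at h1
    omega
  rw [hab] at h'
  have h2 := mul_left_cancel₀ (pow_ne_zero b Polynomial.X_ne_zero) h'
  refine ⟨(Int.sign f.leadingCoeff : ℝ) * c, mul_ne_zero ?_ hc, ?_⟩
  · have : f.leadingCoeff ≠ 0 := Polynomial.leadingCoeff_ne_zero.2 hf
    exact_mod_cast (by simpa [Int.sign_eq_zero_iff_zero] using this :
      Int.sign f.leadingCoeff ≠ 0)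
  · rw [normalizeUnit, hdiv, Polynomial.map_mul, h2, Polynomial.map_C, Polynomial.C_mul, mul_assoc]
    rfl

theorem evenExpansion_evenCF (c : List ℤ) (hc : ∀ a ∈ c, a ≠ 0) :
    evenExpansion (evenCF c) = c := by
  have h : ∃ d, IsEvenExpansion d (evenCF c) := ⟨c, hc, rfl⟩
  rw [evenExpansion, dif_pos h]
  exact evenExpansion_unique _ _ _ h.choose_spec ⟨hc, rfl⟩

/-- The zeros of the Alexander polynomial of the knot of an even continued fraction of even length
whose coefficients at the odd positions are positive. -/
theorem zeros_alexanderTwoBridge (c : List ℤ) (n : ℕ) (hc : c.length = 2 * n)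
    (ho : ∀ k < n, 0 < c.getD (2 * k) 0) (he : ∀ k < n, c.getD (2 * k + 1) 0 ≠ 0) :
    IsBiStable (alexanderTwoBridge (evenCF c)) ∧
      numRealZeros (alexanderTwoBridge (evenCF c)) =
        2 * Fintype.card {i : Fin n // c.getD (2 * i + 1) 0 < 0} ∧
      numUnitZeros (alexanderTwoBridge (evenCF c)) =
        2 * Fintype.card {i : Fin n // 0 < c.getD (2 * i + 1) 0} := by
  have hne : ∀ a ∈ c, a ≠ 0 := by
    intro a ha
    obtain ⟨k, hk, rfl⟩ := List.mem_iff_getElem.1 ha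
    rw [← List.getD_eq_getElem c 0 hk]
    obtain ⟨l, rfl | rfl⟩ := Nat.even_or_odd' k
    · exact (ho l (by omega)).ne'
    · exact he l (by omega)
  set o : ℕ → ℝ := fun k => c.getD (2 * k) 0 with ho_def
  set e : ℕ → ℝ := fun k => c.getD (2 * k + 1) 0 with he_def
  have ho1 : ∀ k < n, (1 : ℝ) ≤ o k := fun k hk => by
    simp only [ho_def]
    exact_mod_cast ho k hk
  have he1 : ∀ k < n, (1 : ℝ) ≤ |e k| := fun k hk => by
    simp only [he_def]
    exact_mod_cast Int.one_le_abs (he k hk)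
  obtain ⟨μ, hμ, hμ0, hpos, hneg⟩ := exists_plumbingSeq_eq_prod o e n
    (fun k hk => by linarith [ho1 k hk]) (fun k hk => Int.cast_ne_zero.2 (he k hk))
  have hμ4 : ∀ i, μ i < 0 ∨ 1 / 4 < μ i := by
    intro i
    by_contra! h
    have h0 : 0 < μ i := lt_of_le_of_ne h.1 (hμ0 i).symm
    -- If `0 < μ i ≤ 1 / 4`, the factor `1 + w * μ i` vanishes at this point, which is at most `-4`.
    refine plumbingSeq_snd_ne_zero o e (-(μ i)⁻¹) ?_ n
      (fun k hk => (ho1 k hk).trans (le_abs_self _)) he1 ?_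
    · have : (4 : ℝ) ≤ (μ i)⁻¹ := by
        rw [le_inv_comm₀ (by norm_num) h0]
        linarith [h.2]
      linarith
    · rw [hμ]
      refine Finset.prod_eq_zero (Finset.mem_univ i) ?_
      field_simp
      ring
  set g := ∏ i, reciprocalQuadratic (μ i)
  have hg0 : g.coeff 0 ≠ 0 := by
    rw [Polynomial.coeff_zero_eq_eval_zero, Polynomial.eval_prod, Finset.prod_ne_zero_iff]
    intro i _
    simpa [reciprocalQuadratic] using hμ0 i
  obtain ⟨a, b, hab⟩ := exists_aeval_det_platDiagram c n hc
  set f := (platDiagram c).reducedAlexanderMatrix.det with hf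
  -- The factor `X ^ n` clears the denominators of `w`; the extra `X` on both sides makes the
  -- identity trivial at `t = 0`, where the evaluation formula is not available.
  have hfg : Polynomial.X ^ (n + 1) * f.map (Int.castRingHom ℝ) =
      Polynomial.C ((-1) ^ a) * (Polynomial.X ^ (b + 1) * g) := by
    refine Polynomial.funext fun t => ?_
    rcases eq_or_ne t 0 with rfl | ht
    · simp
    · have h1 : (f.map (Int.castRingHom ℝ)).eval t = Polynomial.aeval t f := by
        rw [Polynomial.aeval_def, Polynomial.eval_map]
        rfl
      have h2 : g.eval t = t ^ n * ∏ i, (1 + (t - 1) ^ 2 / t * μ i) := by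
        rw [Polynomial.eval_prod]
        conv_rhs => rw [show t ^ n = ∏ _i : Fin n, t by simp, ← Finset.prod_mul_distrib]
        refine Finset.prod_congr rfl fun i _ => ?_
        simp only [reciprocalQuadratic, Polynomial.eval_add, Polynomial.eval_mul,
          Polynomial.eval_C, Polynomial.eval_pow, Polynomial.eval_sub, Polynomial.eval_X,
          Polynomial.eval_one]
        field_simp
        ring
      rw [Polynomial.eval_mul, Polynomial.eval_mul, Polynomial.eval_mul, h1, hab t ht, hμ, h2]
      simp only [Polynomial.eval_pow, Polynomial.eval_X, Polynomial.eval_C]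
      ring
  obtain ⟨d, hd, hd'⟩ := exists_map_normalizeUnit_eq f g hg0 _
    (pow_ne_zero a (by norm_num)) _ _ hfg
  have halex : alexanderTwoBridge (evenCF c) = Polynomial.C d * g := by
    rw [alexanderTwoBridge, twoBridge, evenExpansion_evenCF c hne]
    exact hd'
  have hcard1 : Fintype.card {i : Fin n // e i < 0} =
      Fintype.card {i : Fin n // c.getD (2 * i + 1) 0 < 0} :=
    Fintype.card_congr (Equiv.subtypeEquivRight fun i => by simp [he_def])
  have hcard2 : Fintype.card {i : Fin n // 0 < e i} =
      Fintype.card {i : Fin n // 0 < c.getD (2 * i + 1) 0} :=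
    Fintype.card_congr (Equiv.subtypeEquivRight fun i => by simp [he_def])
  rw [halex, ← hcard1, ← hcard2, ← hpos, ← hneg]
  exact zeros_C_mul_prod_reciprocalQuadratic d hd μ hμ4

/-! ## Constant and alternating blocks -/

theorem card_fin_val_lt (n k : ℕ) (hk : k ≤ n) : Fintype.card {i : Fin n // (i : ℕ) < k} = k := by
  rw [Fintype.card_subtype, Fin.card_filter_val_lt, min_eq_right hk]

theorem card_fin_le_val (n k : ℕ) (hk : k ≤ n) :
    Fintype.card {i : Fin n // k ≤ (i : ℕ)} = n - k := by
  have h := Fintype.card_subtype_compl (fun i : Fin n => (i : ℕ) < k)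
  simp only [not_lt, card_fin_val_lt n k hk, Fintype.card_fin] at h
  exact h

theorem getD_constantBlock {n : ℕ} (a : Fin n → ℤ) (k : ℕ) (hk : k < n) :
    (constantBlock a).getD k 0 = a ⟨k, hk⟩ := by
  rw [constantBlock, List.getD_eq_getElem _ _ (by simpa using hk), List.getElem_ofFn]

theorem getD_alternatingBlock {n : ℕ} (b : Fin n → ℤ) (k : ℕ) (hk : k < n) :
    (alternatingBlock b).getD k 0 = (-1) ^ k * b ⟨k, hk⟩ := by
  rw [alternatingBlock, List.getD_eq_getElem _ _ (by simpa using hk), List.getElem_ofFn]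

theorem theorem13p1 (m p : ℕ) (a : Fin (2 * m) → ℤ) (b : Fin (2 * p) → ℤ)
    (ha : ∀ j, 0 < a j) (hb : ∀ k, 0 < b k) (r : ℚ)
    (hr : r = evenCF (constantBlock a ++ alternatingBlock b) ∨
      r = evenCF (alternatingBlock b ++ constantBlock a)) :
    IsBiStable (alexanderTwoBridge r) ∧
      numRealZeros (alexanderTwoBridge r) = 2 * p ∧
      numUnitZeros (alexanderTwoBridge r) = 2 * m := by
  have hla : (constantBlock a).length = 2 * m := List.length_ofFn
  have hlb : (alternatingBlock b).length = 2 * p := List.length_ofFn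
  have hA : ∀ k < 2 * m, 0 < (constantBlock a).getD k 0 := fun k hk => by
    rw [getD_constantBlock a k hk]
    exact ha _
  have hB0 : ∀ k < p, 0 < (alternatingBlock b).getD (2 * k) 0 := fun k hk => by
    rw [getD_alternatingBlock b _ (by omega), pow_mul, neg_one_sq, one_pow, one_mul]
    exact hb _
  have hB1 : ∀ k < p, (alternatingBlock b).getD (2 * k + 1) 0 < 0 := fun k hk => by
    rw [getD_alternatingBlock b _ (by omega), pow_succ, pow_mul, neg_one_sq, one_pow, one_mul,
      neg_one_mul, neg_lt_zero]
    exact hb _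
  rcases hr with rfl | rfl
  · set c := constantBlock a ++ alternatingBlock b
    have hl : ∀ k < 2 * m, c.getD k 0 = (constantBlock a).getD k 0 := fun k hk =>
      List.getD_append _ _ _ _ (by omega)
    have hr : ∀ k, 2 * m ≤ k → c.getD k 0 = (alternatingBlock b).getD (k - 2 * m) 0 :=
      fun k hk => by rw [← hla]; exact List.getD_append_right _ _ _ _ (by omega)
    -- The first block has even length, so the second one keeps its index parity; zero-based even
    -- indices of the alternating block carry the positive sign.
    have ho : ∀ k < m + p, 0 < c.getD (2 * k) 0 := fun k hk => by
      rcases lt_or_ge k m with h | h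
      · rw [hl _ (by omega)]
        exact hA _ (by omega)
      · rw [hr _ (by omega), ← Nat.mul_sub]
        exact hB0 _ (by omega)
    have he1 : ∀ k < m, 0 < c.getD (2 * k + 1) 0 := fun k hk => by
      rw [hl _ (by omega)]
      exact hA _ (by omega)
    have he2 : ∀ k < m + p, m ≤ k → c.getD (2 * k + 1) 0 < 0 := fun k hk h => by
      rw [hr _ (by omega), show 2 * k + 1 - 2 * m = 2 * (k - m) + 1 by omega]
      exact hB1 _ (by omega)
    obtain ⟨h1, h2, h3⟩ := zeros_alexanderTwoBridge c (m + p)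
      (by rw [List.length_append, hla, hlb]; ring) ho fun k hk => by
        rcases lt_or_ge k m with h | h
        · exact (he1 k h).ne'
        · exact (he2 k hk h).ne
    refine ⟨h1, h2.trans ?_, h3.trans ?_⟩
    · rw [Fintype.card_congr (Equiv.subtypeEquivRight fun i : Fin (m + p) =>
        (⟨fun h => not_lt.1 fun h' => (he1 i h').not_gt h, he2 i i.2⟩ :
          c.getD (2 * i + 1) 0 < 0 ↔ m ≤ (i : ℕ))), card_fin_le_val _ _ (by omega)]
      omega
    · rw [Fintype.card_congr (Equiv.subtypeEquivRight fun i : Fin (m + p) =>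
        (⟨fun h => not_le.1 fun h' => (he2 i i.2 h').not_gt h, he1 i⟩ :
          0 < c.getD (2 * i + 1) 0 ↔ (i : ℕ) < m)), card_fin_val_lt _ _ (by omega)]
  · set c := alternatingBlock b ++ constantBlock a
    have hl : ∀ k < 2 * p, c.getD k 0 = (alternatingBlock b).getD k 0 := fun k hk =>
      List.getD_append _ _ _ _ (by omega)
    have hr : ∀ k, 2 * p ≤ k → c.getD k 0 = (constantBlock a).getD (k - 2 * p) 0 :=
      fun k hk => by rw [← hlb]; exact List.getD_append_right _ _ _ _ (by omega)
    have ho : ∀ k < p + m, 0 < c.getD (2 * k) 0 := fun k hk => by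
      rcases lt_or_ge k p with h | h
      · rw [hl _ (by omega)]
        exact hB0 _ h
      · rw [hr _ (by omega)]
        exact hA _ (by omega)
    have he1 : ∀ k < p, c.getD (2 * k + 1) 0 < 0 := fun k hk => by
      rw [hl _ (by omega)]
      exact hB1 _ hk
    have he2 : ∀ k < p + m, p ≤ k → 0 < c.getD (2 * k + 1) 0 := fun k hk h => by
      rw [hr _ (by omega)]
      exact hA _ (by omega)
    obtain ⟨h1, h2, h3⟩ := zeros_alexanderTwoBridge c (p + m)
      (by rw [List.length_append, hla, hlb]; ring) ho fun k hk => by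
        rcases lt_or_ge k p with h | h
        · exact (he1 k h).ne
        · exact (he2 k hk h).ne'
    refine ⟨h1, h2.trans ?_, h3.trans ?_⟩
    · rw [Fintype.card_congr (Equiv.subtypeEquivRight fun i : Fin (p + m) =>
        (⟨fun h => not_le.1 fun h' => (he2 i i.2 h').not_gt h, he1 i⟩ :
          c.getD (2 * i + 1) 0 < 0 ↔ (i : ℕ) < p)), card_fin_val_lt _ _ (by omega)]
    · rw [Fintype.card_congr (Equiv.subtypeEquivRight fun i : Fin (p + m) =>
        (⟨fun h => not_lt.1 fun h' => (he1 i h').not_gt h, he2 i i.2⟩ :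
          0 < c.getD (2 * i + 1) 0 ↔ p ≤ (i : ℕ))), card_fin_le_val _ _ (by omega)]
      omega
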